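/- Let $D\ge 2$ and let $|\cdot|$ be the Euclidean norm on $\mathbb R^D$. There is a constant $C>0$, depending only on $D$, such that the following holds. Let $0<\varepsilon<C$ and let $k$ be an integer with $1\le k\le D$. Then there exists $\delta>0$, depending only on $\varepsilon$, $k$ and $D$, with the following property. Let $y_1,\dots,y_k$ be pairwise distinct points of $\mathbb R^D$ and let $z_1,\dots,z_k$ be pairwise distinct points of $\mathbb R^D$ such that $$(1+\delta)^{-1}\le \frac{|z_i-z_j|}{|y_i-y_j|}\le 1+\delta,\qquad 1\le i,j\le k,\ i\ne j.$$ Then there exists a ($C^\infty$) diffeomorphism $\Phi$ of $\mathbb R^D$ onto $\mathbb R^D$ (in particular, $\Phi$ is one-to-one and onto) such that $$(1+\varepsilon)^{-1}|x-y|\le |\Phi(x)-\Phi(y)|\le (1+\varepsilon)|x-y|\qquad\text{for all } x,y\in\mathbb R^D,$$ and $\Phi(y_i)=z_i$ for all $1\le i\le k$. -/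

import Mathlib

open scoped Manifold ContDiff

/-- A `k`-point configuration in `ℝ^D`: a family of `k` pairwise distinct points `y 0, …, y (k-1)`
of Euclidean space. -/
def IsPointConfiguration {D k : ℕ} (y : Fin k → EuclideanSpace ℝ (Fin D)) : Prop :=
  ∀ i j : Fin k, i ≠ j → y i ≠ y j

/-! Induct on the number of points, peeling off one point of a closest pair `y i₀`, `y j₀`. The
induction hypothesis gives a diffeomorphism that is correct at all points except `y i₀`. The image
of `y i₀` and its target then both lie within a bounded multiple of the minimal separation `r` of
the same point `z j₀`, so a single point remains to be moved (`exists_move_one_point`).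

By pigeonhole, some annulus around that centre, of fixed ratio `K` and radius comparable to `r`,
contains no point of the configuration (`exists_empty_annulus`). The points inside it form a cluster
of bounded size relative to `r`, so compactness supplies a linear isometry that almost matches it to
its target (`exists_approx_linearIsometryEquiv`). The isometry is cut off to the identity across the
empty annulus by a rotation varying slowly in `log ‖x‖`, at small distortion (`exists_twist`). The
remaining errors, small compared with `r`, are removed by bump functions (`exists_slide`).

The cutoff needs an isometry that can be deformed to the identity, that is, an even product of
reflections. This is where the bound on the number of points enters: at most `D` points, one of them
the origin, lie in a hyperplane, and reflecting in it changes the parity without moving them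
(`exists_even_reflectionProd`). -/

open Submodule Module Metric

/-! ### Near-isometric diffeomorphisms and their composition. -/

section NearIsometry

variable {E : Type*} [NormedAddCommGroup E] [InnerProductSpace ℝ E]

/-- `Φ` and its inverse are both `Λ`-Lipschitz. -/
def IsNearIsometry (Λ : ℝ) (Φ : Diffeomorph 𝓘(ℝ, E) 𝓘(ℝ, E) E E ∞) : Prop :=
  ∀ x y : E, ‖Φ x - Φ y‖ ≤ Λ * ‖x - y‖ ∧ ‖x - y‖ ≤ Λ * ‖Φ x - Φ y‖

/-- The diffeomorphism given by a smooth map of a vector space and its smooth inverse. -/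
def diffeoOfInverse (f g : E → E) (hf : ContDiff ℝ ∞ f) (hg : ContDiff ℝ ∞ g)
    (hgf : Function.LeftInverse g f) (hfg : Function.RightInverse g f) :
    Diffeomorph 𝓘(ℝ, E) 𝓘(ℝ, E) E E ∞ where
  toFun := f
  invFun := g
  left_inv := hgf
  right_inv := hfg
  contMDiff_toFun := hf.contMDiff
  contMDiff_invFun := hg.contMDiff

theorem IsNearIsometry.mono {Λ Λ' : ℝ} {Φ : Diffeomorph 𝓘(ℝ, E) 𝓘(ℝ, E) E E ∞}
    (h : IsNearIsometry Λ Φ) (hΛ : Λ ≤ Λ') : IsNearIsometry Λ' Φ := fun x y =>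
  ⟨(h x y).1.trans (by gcongr), (h x y).2.trans (by gcongr)⟩

theorem isNearIsometry_refl : IsNearIsometry 1 (Diffeomorph.refl 𝓘(ℝ, E) E ∞) := fun x y => by
  simp

theorem IsNearIsometry.trans {Λ Λ' : ℝ} (hΛ : 0 ≤ Λ) (hΛ' : 0 ≤ Λ')
    {Φ Ψ : Diffeomorph 𝓘(ℝ, E) 𝓘(ℝ, E) E E ∞}
    (h : IsNearIsometry Λ Φ) (h' : IsNearIsometry Λ' Ψ) :
    IsNearIsometry (Λ * Λ') (Φ.trans Ψ) := fun x y => by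
  have h1 := h x y
  have h2 := h' (Φ x) (Φ y)
  simp only [Diffeomorph.coe_trans, Function.comp_apply]
  constructor
  · calc _ ≤ Λ' * ‖Φ x - Φ y‖ := h2.1
      _ ≤ Λ' * (Λ * ‖x - y‖) := by gcongr; exact h1.1
      _ = _ := by ring
  · calc _ ≤ Λ * ‖Φ x - Φ y‖ := h1.2
      _ ≤ Λ * (Λ' * ‖Ψ (Φ x) - Ψ (Φ y)‖) := by gcongr; exact h2.2
      _ = _ := by ring

/-- Translation by `v` as a diffeomorphism. -/
def translationDiffeo (v : E) : Diffeomorph 𝓘(ℝ, E) 𝓘(ℝ, E) E E ∞ :=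
  diffeoOfInverse (fun x => x + v) (fun x => x - v) (by fun_prop) (by fun_prop)
    (fun x => by simp) (fun x => by simp)

@[simp]
theorem translationDiffeo_apply (v x : E) : translationDiffeo v x = x + v :=
  rfl

theorem isNearIsometry_translationDiffeo (v : E) : IsNearIsometry 1 (translationDiffeo v) :=
  fun x y => by simp

end NearIsometry

/-! ### The logarithmic cutoff parameter. -/

section LogRadius

variable {E : Type*} [NormedAddCommGroup E]

/-- Smooth logarithmic cutoff parameter: nonpositive for `‖x‖ ≤ ρ`, growing with slope `c` in
`log ‖x‖`. -/
noncomputable def logRadius (c ρ : ℝ) (x : E) : ℝ :=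
  c * (Real.log (ρ ^ 2 + ‖x‖ ^ 2) - Real.log (2 * ρ ^ 2))

theorem logRadius_nonpos {c ρ : ℝ} (hc : 0 < c) (hρ : 0 < ρ) {x : E} (hx : ‖x‖ ≤ ρ) :
    logRadius c ρ x ≤ 0 := by
  refine mul_nonpos_of_nonneg_of_nonpos hc.le (sub_nonpos.2 (Real.log_le_log (by positivity) ?_))
  nlinarith [norm_nonneg x]

theorem one_le_logRadius {c ρ : ℝ} (hc : 0 < c) (hρ : 0 < ρ) {x : E}
    (hx : Real.exp c⁻¹ * ρ ≤ ‖x‖) : 1 ≤ logRadius c ρ x := by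
  have h : c⁻¹ ≤ Real.log (ρ ^ 2 + ‖x‖ ^ 2) - Real.log (2 * ρ ^ 2) := by
    rw [le_sub_iff_add_le, Real.le_log_iff_exp_le (by positivity), Real.exp_add,
      Real.exp_log (by positivity)]
    have h0 : 0 ≤ Real.exp c⁻¹ * ρ := by positivity
    nlinarith [sq_nonneg (Real.exp c⁻¹ * ρ - ρ)]
  unfold logRadius
  calc (1 : ℝ) = c * c⁻¹ := by field_simp
    _ ≤ _ := by gcongr

/-- The gradient of `log (ρ² + ‖x‖²)` is at most `2 / ‖x‖`. The factor `‖y‖` compensates for this,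
giving a bound independent of the scale `ρ`; this is why the cutoff is logarithmic. -/
theorem abs_logRadius_sub_mul_norm_le {c ρ : ℝ} (hc : 0 < c) (hρ : 0 < ρ) {x y : E}
    (hxy : ‖y‖ ≤ ‖x‖) : |logRadius c ρ x - logRadius c ρ y| * ‖y‖ ≤ 2 * c * ‖x - y‖ := by
  rcases (norm_nonneg y).eq_or_lt with hy | hy
  · rw [← hy]; simp; positivity
  have hx : 0 < ‖x‖ := hy.trans_le hxy
  have h1 : Real.log (ρ ^ 2 + ‖y‖ ^ 2) ≤ Real.log (ρ ^ 2 + ‖x‖ ^ 2) :=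
    Real.log_le_log (by positivity) (by gcongr)
  have h2 : Real.log (ρ ^ 2 + ‖x‖ ^ 2) - Real.log (ρ ^ 2 + ‖y‖ ^ 2) ≤ 2 * (‖x‖ / ‖y‖ - 1) := by
    rw [← Real.log_div (by positivity) (by positivity)]
    calc _ ≤ Real.log ((‖x‖ / ‖y‖) ^ 2) := by
          refine Real.log_le_log (by positivity) ?_
          rw [div_pow, div_le_div_iff₀ (by positivity) (by positivity)]
          have : ‖y‖ ^ 2 ≤ ‖x‖ ^ 2 := by gcongr
          nlinarith [sq_nonneg ρ]
      _ = 2 * Real.log (‖x‖ / ‖y‖) := by rw [Real.log_pow]; norm_num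
      _ ≤ _ := by gcongr; exact Real.log_le_sub_one_of_pos (by positivity)
  have h3 : ‖x‖ - ‖y‖ ≤ ‖x - y‖ := norm_sub_norm_le x y
  have h4 : logRadius c ρ x - logRadius c ρ y
      = c * (Real.log (ρ ^ 2 + ‖x‖ ^ 2) - Real.log (ρ ^ 2 + ‖y‖ ^ 2)) := by
    unfold logRadius; ring
  rw [h4, abs_of_nonneg (mul_nonneg hc.le (sub_nonneg.2 h1))]
  calc _ ≤ c * (2 * (‖x‖ / ‖y‖ - 1)) * ‖y‖ := by gcongr
    _ = 2 * c * (‖x‖ - ‖y‖) := by field_simp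
    _ ≤ _ := by gcongr

end LogRadius

/-! ### Slow twists from a product of two reflections to the identity. -/

section Twist

variable {E : Type*} [NormedAddCommGroup E] [InnerProductSpace ℝ E]

theorem contDiff_logRadius (c : ℝ) {ρ : ℝ} (hρ : 0 < ρ) :
    ContDiff ℝ ∞ (logRadius c ρ : E → ℝ) := by
  unfold logRadius
  refine contDiff_const.mul (ContDiff.sub ?_ contDiff_const)
  exact (contDiff_const.add (contDiff_norm_sq ℝ)).log fun x => by positivity

/-- Split the difference as `G s (x - y) + (G s - G t) y`. The first term is isometric; the second
is controlled by the logarithmic slope, provided `y` is the shorter vector. -/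
theorem norm_radial_sub_le {G : ℝ → E ≃ₗᵢ[ℝ] E} {L c ρ : ℝ} (hL : 0 ≤ L) (hc : 0 < c) (hρ : 0 < ρ)
    (hG : ∀ s t x, ‖G s x - G t x‖ ≤ L * |s - t| * ‖x‖) (x y : E) :
    ‖G (logRadius c ρ x) x - G (logRadius c ρ y) y‖ ≤ (1 + 2 * c * L) * ‖x - y‖ := by
  wlog hxy : ‖y‖ ≤ ‖x‖ generalizing x y
  · rw [norm_sub_rev, norm_sub_rev x y]
    exact this y x (le_of_not_ge hxy)
  calc _ = ‖G (logRadius c ρ x) (x - y) + (G (logRadius c ρ x) y - G (logRadius c ρ y) y)‖ := by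
        rw [map_sub]; congr 1; abel
    _ ≤ ‖G (logRadius c ρ x) (x - y)‖ + ‖G (logRadius c ρ x) y - G (logRadius c ρ y) y‖ :=
        norm_add_le _ _
    _ ≤ ‖x - y‖ + L * (|logRadius c ρ x - logRadius c ρ y| * ‖y‖) := by
        rw [LinearIsometryEquiv.norm_map, ← mul_assoc]; gcongr; exact hG _ _ _
    _ ≤ ‖x - y‖ + L * (2 * c * ‖x - y‖) := by
        gcongr ‖x - y‖ + L * ?_; exact abs_logRadius_sub_mul_norm_le hc hρ hxy
    _ = _ := by ring

/-- A slow twist along a Lipschitz one-parameter family of linear isometries. -/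
theorem exists_radial_twist {G : ℝ → E ≃ₗᵢ[ℝ] E} {L c ρ : ℝ} (hL : 0 ≤ L) (hc : 0 < c) (hρ : 0 < ρ)
    (hG : ∀ s t x, ‖G s x - G t x‖ ≤ L * |s - t| * ‖x‖)
    (hsm : ContDiff ℝ ∞ fun p : ℝ × E => G p.1 p.2)
    (hsm' : ContDiff ℝ ∞ fun p : ℝ × E => (G p.1).symm p.2) :
    ∃ Φ : Diffeomorph 𝓘(ℝ, E) 𝓘(ℝ, E) E E ∞, IsNearIsometry (1 + 2 * c * L) Φ ∧
      ∀ x, Φ x = G (logRadius c ρ x) x := by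
  have hG' : ∀ s t x, ‖(G s).symm x - (G t).symm x‖ ≤ L * |s - t| * ‖x‖ := fun s t x => by
    have h := hG t s ((G t).symm x)
    rw [← (G s).symm.norm_map (_ - _)] at h
    simpa [abs_sub_comm t s, norm_sub_rev] using h
  -- The twist preserves each sphere, so its inverse is the twist by the inverse isometries and
  -- obeys the same estimate.
  have hrad : ∀ (A : E ≃ₗᵢ[ℝ] E) x, logRadius c ρ (A x) = logRadius c ρ x := fun A x => by
    simp [logRadius]
  let f : E → E := fun x => G (logRadius c ρ x) x
  let g : E → E := fun x => (G (logRadius c ρ x)).symm x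
  have hgf : Function.LeftInverse g f := fun x => by simp [f, g, hrad]
  have hfg : Function.RightInverse g f := fun x => by simp [f, g, hrad]
  refine ⟨diffeoOfInverse f g (hsm.comp ((contDiff_logRadius c hρ).prodMk contDiff_id))
    (hsm'.comp ((contDiff_logRadius c hρ).prodMk contDiff_id)) hgf hfg, fun x y => ⟨?_, ?_⟩,
    fun x => rfl⟩
  · exact norm_radial_sub_le hL hc hρ hG x y
  · have h := norm_radial_sub_le (G := fun t => (G t).symm) hL hc hρ hG' (f x) (f y)
    change ‖g (f x) - g (f y)‖ ≤ _ at h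
    rwa [hgf, hgf] at h

theorem exists_smoothTransition_lipschitz :
    ∃ L : ℝ, 0 ≤ L ∧ ∀ s t, |Real.smoothTransition s - Real.smoothTransition t| ≤ L * |s - t| := by
  have hd : Differentiable ℝ Real.smoothTransition :=
    (Real.smoothTransition.contDiff (n := 1)).differentiable (by norm_num)
  have hc : Continuous (deriv Real.smoothTransition) :=
    (Real.smoothTransition.contDiff (n := 1)).continuous_deriv (by norm_num)
  obtain ⟨L, hL⟩ := (isCompact_Icc (a := (0 : ℝ)) (b := 1)).exists_bound_of_continuousOn
    hc.continuousOn
  have hL0 : 0 ≤ L := (norm_nonneg _).trans (hL 0 (by simp))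
  have hb : ∀ x ∈ Set.univ, ‖deriv Real.smoothTransition x‖ ≤ L := fun x _ => by
    by_cases h0 : x < 0
    · have : Real.smoothTransition =ᶠ[nhds x] fun _ => 0 := by
        filter_upwards [gt_mem_nhds h0] with y hy
        exact Real.smoothTransition.zero_of_nonpos (le_of_lt hy)
      rw [this.deriv_eq]; simpa using hL0
    by_cases h1 : 1 < x
    · have : Real.smoothTransition =ᶠ[nhds x] fun _ => 1 := by
        filter_upwards [lt_mem_nhds h1] with y hy
        exact Real.smoothTransition.one_of_one_le (le_of_lt hy)
      rw [this.deriv_eq]; simpa using hL0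
    · exact hL x ⟨not_lt.1 h0, not_lt.1 h1⟩
  refine ⟨L, hL0, fun s t => ?_⟩
  exact convex_univ.norm_image_sub_le_of_norm_deriv_le (fun x _ => hd x) hb (Set.mem_univ t)
    (Set.mem_univ s)

theorem reflection_orthogonal_singleton_apply [FiniteDimensional ℝ E] (w x : E) :
    (ℝ ∙ w)ᗮ.reflection x = x - (2 * (inner ℝ w x / ‖w‖ ^ 2)) • w := by
  rw [reflection_orthogonal_apply, reflection_singleton_apply]
  simp [mul_smul, two_smul]

theorem norm_inner_smul_sub_le {a b : E} (ha : ‖a‖ = 1) (hb : ‖b‖ = 1) (x : E) :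
    ‖inner ℝ a x • a - inner ℝ b x • b‖ ≤ 2 * ‖a - b‖ * ‖x‖ := by
  calc _ = ‖inner ℝ a x • (a - b) + inner ℝ (a - b) x • b‖ := by
        rw [inner_sub_left, smul_sub, sub_smul]; congr 1; abel
    _ ≤ ‖inner ℝ a x • (a - b)‖ + ‖inner ℝ (a - b) x • b‖ := norm_add_le _ _
    _ ≤ ‖a‖ * ‖x‖ * ‖a - b‖ + ‖a - b‖ * ‖x‖ * ‖b‖ := by
        rw [norm_smul, norm_smul]; gcongr <;> exact norm_inner_le_norm _ _
    _ = _ := by rw [ha, hb]; ring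

theorem norm_normalize_sub_le {a b : E} (ha : 1 / 2 ≤ ‖a‖) (hb : 1 / 2 ≤ ‖b‖) :
    ‖‖a‖⁻¹ • a - ‖b‖⁻¹ • b‖ ≤ 4 * ‖a - b‖ := by
  have ha0 : 0 < ‖a‖ := by linarith
  have hb0 : 0 < ‖b‖ := by linarith
  calc _ = ‖‖a‖⁻¹ • ((a - b) + (‖b‖ - ‖a‖) • ‖b‖⁻¹ • b)‖ := by
        congr 1
        have h : ‖a‖⁻¹ * (‖b‖ - ‖a‖) * ‖b‖⁻¹ = ‖a‖⁻¹ - ‖b‖⁻¹ := by field_simp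
        rw [smul_add, smul_sub, smul_smul, smul_smul, h, sub_smul]; abel
    _ = ‖a‖⁻¹ * ‖(a - b) + (‖b‖ - ‖a‖) • ‖b‖⁻¹ • b‖ := by
        rw [norm_smul, norm_inv, norm_norm]
    _ ≤ 2 * (‖a - b‖ + ‖a - b‖) := by
        have h1 : ‖a‖⁻¹ ≤ 2 := by
          rw [inv_le_comm₀ ha0 two_pos]; linarith
        have h2 : ‖(‖b‖ - ‖a‖) • ‖b‖⁻¹ • b‖ ≤ ‖a - b‖ := by
          rw [norm_smul, norm_smul, norm_inv, norm_norm, inv_mul_cancel₀ hb0.ne', mul_one,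
            norm_sub_rev a b]
          exact abs_norm_sub_norm_le b a
        gcongr
        exact (norm_add_le _ _).trans (by gcongr)
    _ = _ := by ring

theorem norm_reflection_sub_le [FiniteDimensional ℝ E] {a b : E} (ha : 1 / 2 ≤ ‖a‖)
    (hb : 1 / 2 ≤ ‖b‖) (x : E) :
    ‖(ℝ ∙ a)ᗮ.reflection x - (ℝ ∙ b)ᗮ.reflection x‖ ≤ 16 * ‖a - b‖ * ‖x‖ := by
  have key : ∀ w : E, 1 / 2 ≤ ‖w‖ → (ℝ ∙ w)ᗮ.reflection x
      = x - (2 : ℝ) • inner ℝ (‖w‖⁻¹ • w) x • (‖w‖⁻¹ • w) := fun w hw => by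
    rw [reflection_orthogonal_singleton_apply, inner_smul_left, smul_smul, smul_smul]
    congr 2
    simp only [conj_trivial]
    field_simp
  have hn : ∀ w : E, 1 / 2 ≤ ‖w‖ → ‖‖w‖⁻¹ • w‖ = 1 := fun w hw => by
    rw [norm_smul, norm_inv, norm_norm, inv_mul_cancel₀]; linarith
  rw [key a ha, key b hb, sub_sub_sub_cancel_left, ← smul_sub, norm_smul, norm_sub_rev]
  calc _ ≤ ‖(2 : ℝ)‖ * (2 * (4 * ‖a - b‖) * ‖x‖) := by
        gcongr
        exact (norm_inner_smul_sub_le (hn a ha) (hn b hb) x).trans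
          (by gcongr; exact norm_normalize_sub_le ha hb)
    _ = _ := by norm_num; ring

theorem half_le_norm_add_smul_sub {u v : E} (hu : ‖u‖ = 1) (hv : ‖v‖ = 1) (huv : 0 ≤ inner ℝ u v)
    {t : ℝ} (h0 : 0 ≤ t) (h1 : t ≤ 1) : 1 / 2 ≤ ‖v + t • (u - v)‖ := by
  have h : ‖v + t • (u - v)‖ ^ 2 = (1 - t) ^ 2 + t ^ 2 + 2 * (t * (1 - t) * inner ℝ u v) := by
    have : v + t • (u - v) = (1 - t) • v + t • u := by
      rw [smul_sub, sub_smul, one_smul]; abel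
    rw [this, norm_add_sq_real, norm_smul, norm_smul, inner_smul_left, inner_smul_right,
      real_inner_comm, hu, hv, mul_one, mul_one, Real.norm_eq_abs, Real.norm_eq_abs, sq_abs, sq_abs]
    simp only [conj_trivial]; ring
  have h2 : 0 ≤ t * (1 - t) * inner ℝ u v :=
    mul_nonneg (mul_nonneg h0 (by linarith)) huv
  have h3 : (1 / 2) ^ 2 ≤ ‖v + t • (u - v)‖ ^ 2 := by
    rw [h]; nlinarith [sq_nonneg (2 * t - 1)]
  exact (sq_le_sq₀ (by norm_num) (norm_nonneg _)).1 h3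

theorem exists_unit_span_eq {w : E} (hw : w ≠ 0) : ∃ v : E, ‖v‖ = 1 ∧ (ℝ ∙ v) = (ℝ ∙ w) := by
  refine ⟨‖w‖⁻¹ • w, ?_, ?_⟩
  · rw [norm_smul, norm_inv, norm_norm, inv_mul_cancel₀ (norm_ne_zero_iff.2 hw)]
  · exact span_singleton_smul_eq (isUnit_iff_ne_zero.2 (inv_ne_zero (norm_ne_zero_iff.2 hw))) w

/-- The composition of two reflections can be cut off to the identity at small distortion. -/
theorem exists_twist_pair [FiniteDimensional ℝ E] {Λ : ℝ} (hΛ : 1 < Λ) :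
    ∃ K : ℝ, 1 ≤ K ∧ ∀ u v : E, u ≠ 0 → v ≠ 0 → ∀ ρ : ℝ, 0 < ρ →
      ∃ Φ : Diffeomorph 𝓘(ℝ, E) 𝓘(ℝ, E) E E ∞, IsNearIsometry Λ Φ ∧
        (∀ x, ‖x‖ ≤ ρ → Φ x = (ℝ ∙ u)ᗮ.reflection ((ℝ ∙ v)ᗮ.reflection x)) ∧
        ∀ x, K * ρ ≤ ‖x‖ → Φ x = x := by
  obtain ⟨L, hL0, hL⟩ := exists_smoothTransition_lipschitz
  -- The family `G` below has Lipschitz constant `32 * L`: 16 from moving the reflection vector, 2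
  -- from `‖u - v‖ ≤ 2`. The `+ 1` keeps the denominator positive when `L = 0`.
  set c : ℝ := (Λ - 1) / (2 * (32 * L + 1)) with hc_def
  have hc : 0 < c := div_pos (by linarith) (by positivity)
  refine ⟨Real.exp c⁻¹, Real.one_le_exp (by positivity), fun u₀ v₀ hu₀ hv₀ ρ hρ => ?_⟩
  obtain ⟨u, hu, hu'⟩ := exists_unit_span_eq hu₀
  -- A reflection depends only on the line, so the sign of `v` is free; with nonnegative inner
  -- product the segment from `v` to `u` avoids the origin.
  obtain ⟨v, hv, hv', huv⟩ : ∃ v : E, ‖v‖ = 1 ∧ (ℝ ∙ v) = (ℝ ∙ v₀) ∧ 0 ≤ inner ℝ u v := by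
    obtain ⟨v, hv, hv'⟩ := exists_unit_span_eq hv₀
    rcases le_total 0 (inner ℝ u v) with h | h
    · exact ⟨v, hv, hv', h⟩
    · refine ⟨-v, by simpa using hv, ?_, by simpa using h⟩
      rw [← hv', ← Set.neg_singleton, Submodule.span_neg]
  simp only [← hu', ← hv']
  -- As `w` runs from `v` to `u`, the reflection in `uᗮ` composed with that in `wᗮ` runs from the
  -- desired product to the square of a reflection, which is the identity.
  let w : ℝ → E := fun t => v + Real.smoothTransition t • (u - v)
  have hw : ∀ t, 1 / 2 ≤ ‖w t‖ := fun t =>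
    half_le_norm_add_smul_sub hu hv huv (Real.smoothTransition.nonneg t)
      (Real.smoothTransition.le_one t)
  have hwL : ∀ s t, ‖w s - w t‖ ≤ 2 * (L * |s - t|) := fun s t => by
    have : w s - w t = (Real.smoothTransition s - Real.smoothTransition t) • (u - v) := by
      simp only [w, sub_smul]; abel
    rw [this, norm_smul, mul_comm]
    gcongr
    · exact (norm_sub_le u v).trans (by rw [hu, hv]; norm_num)
    · exact hL s t
  have hws : ContDiff ℝ ∞ w :=
    contDiff_const.add (Real.smoothTransition.contDiff.smul contDiff_const)
  have hrefl : ContDiff ℝ ∞ fun p : ℝ × E => (ℝ ∙ w p.1)ᗮ.reflection p.2 := by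
    simp only [reflection_orthogonal_singleton_apply]
    have h1 : ContDiff ℝ ∞ fun p : ℝ × E => w p.1 := hws.comp contDiff_fst
    have h0 : ∀ p : ℝ × E, ‖w p.1‖ ^ 2 ≠ 0 := fun p => by
      have := hw p.1; positivity
    exact contDiff_snd.sub ((contDiff_const.mul
      ((h1.inner ℝ contDiff_snd).div (h1.norm_sq ℝ) h0)).smul h1)
  let G : ℝ → E ≃ₗᵢ[ℝ] E := fun t => (ℝ ∙ w t)ᗮ.reflection.trans (ℝ ∙ u)ᗮ.reflection
  have hG : ∀ s t x, ‖G s x - G t x‖ ≤ (32 * L) * |s - t| * ‖x‖ := fun s t x => by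
    simp only [G, LinearIsometryEquiv.trans_apply]
    rw [← map_sub, LinearIsometryEquiv.norm_map]
    refine (norm_reflection_sub_le (hw s) (hw t) x).trans ?_
    calc _ ≤ 16 * (2 * (L * |s - t|)) * ‖x‖ := by gcongr; exact hwL s t
      _ = _ := by ring
  have hsm : ContDiff ℝ ∞ fun p : ℝ × E => G p.1 p.2 :=
    (ℝ ∙ u)ᗮ.reflection.contDiff.comp hrefl
  have hsm' : ContDiff ℝ ∞ fun p : ℝ × E => (G p.1).symm p.2 :=
    hrefl.comp (contDiff_fst.prodMk ((ℝ ∙ u)ᗮ.reflection.contDiff.comp contDiff_snd))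
  obtain ⟨Φ, hΦ, hΦe⟩ := exists_radial_twist (by positivity) hc hρ hG hsm hsm'
  refine ⟨Φ, hΦ.mono ?_, fun x hx => ?_, fun x hx => ?_⟩
  · have : 2 * c * (32 * L + 1) = Λ - 1 := by rw [hc_def]; field_simp
    nlinarith
  · rw [hΦe]
    simp [G, w, Real.smoothTransition.zero_of_nonpos (logRadius_nonpos hc hρ hx)]
  · rw [hΦe]
    simp [G, w, Real.smoothTransition.one_of_one_le (one_le_logRadius hc hρ hx)]

end Twist

/-! ### Small displacements of separated points. -/

section Slide

variable {E : Type*} [NormedAddCommGroup E] [InnerProductSpace ℝ E] [FiniteDimensional ℝ E]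

/-- A smooth perturbation of the identity by a map with small Lipschitz constant is a
near-isometric diffeomorphism. -/
theorem exists_diffeo_add_of_lipschitz {Λ : ℝ} (hΛ : 1 < Λ) :
    ∃ c : ℝ, 0 < c ∧ ∀ g : E → E, ContDiff ℝ ∞ g → (∀ x y, ‖g x - g y‖ ≤ c * ‖x - y‖) →
      ∃ Φ : Diffeomorph 𝓘(ℝ, E) 𝓘(ℝ, E) E E ∞, IsNearIsometry Λ Φ ∧ ∀ x, Φ x = x + g x := by
  have hΛ0 : 0 < Λ := by linarith
  -- With this `c`, `1 - c = Λ⁻¹` gives the lower bound and `1 + c ≤ Λ` the upper one.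
  refine ⟨(Λ - 1) / Λ, div_pos (by linarith) hΛ0, fun g hg hgL => ?_⟩
  set c : ℝ := (Λ - 1) / Λ with hc_def
  have hc0 : 0 ≤ c := div_nonneg (by linarith) hΛ0.le
  have hc1 : c < 1 := by rw [hc_def, div_lt_one hΛ0]; linarith
  have hcΛ : Λ * (1 - c) = 1 := by rw [hc_def]; field_simp; ring
  obtain ⟨κ, hκ⟩ : ∃ κ : NNReal, (κ : ℝ) = c := ⟨⟨c, hc0⟩, rfl⟩
  have hgLip : LipschitzWith κ g := LipschitzWith.of_dist_le_mul fun x y => by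
    simpa [dist_eq_norm, hκ] using hgL x y
  let f : E → E := fun x => x + g x
  have hf : ContDiff ℝ ∞ f := contDiff_id.add hg
  have happ : ApproximatesLinearOn f ((ContinuousLinearEquiv.refl ℝ E : E ≃L[ℝ] E) : E →L[ℝ] E)
      Set.univ κ := by
    refine LipschitzOnWith.approximatesLinearOn ?_
    have : f - ⇑((ContinuousLinearEquiv.refl ℝ E : E ≃L[ℝ] E) : E →L[ℝ] E) = g := by
      ext x; simp [f]
    rw [this]
    exact hgLip.lipschitzOnWith
  have hN : Subsingleton E ∨ κ
      < ‖(((ContinuousLinearEquiv.refl ℝ E : E ≃L[ℝ] E).symm : E ≃L[ℝ] E) : E →L[ℝ] E)‖₊⁻¹ := by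
    rcases subsingleton_or_nontrivial E with h | h
    · exact Or.inl h
    · right
      have : ‖(((ContinuousLinearEquiv.refl ℝ E : E ≃L[ℝ] E).symm : E ≃L[ℝ] E) : E →L[ℝ] E)‖₊
          = 1 := by
        rw [← NNReal.coe_inj]
        exact ContinuousLinearMap.norm_id
      rw [this, inv_one, ← NNReal.coe_lt_coe, hκ]
      exact hc1
  let h : E ≃ₜ E := happ.toHomeomorph f hN
  have hfd : ∀ x, ∃ A : E ≃L[ℝ] E, HasFDerivAt f (A : E →L[ℝ] E) x := fun x => by
    have hgd : HasFDerivAt g (fderiv ℝ g x) x := (hg.differentiable (by simp) x).hasFDerivAt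
    have hn : ‖-fderiv ℝ g x‖ < 1 := by
      rw [norm_neg]
      exact (norm_fderiv_le_of_lipschitz ℝ hgLip).trans_lt (hκ ▸ hc1)
    refine ⟨ContinuousLinearEquiv.unitsEquiv ℝ E (Units.oneSub _ hn), ?_⟩
    have hA : ((ContinuousLinearEquiv.unitsEquiv ℝ E (Units.oneSub _ hn) : E ≃L[ℝ] E) : E →L[ℝ] E)
        = ContinuousLinearMap.id ℝ E + fderiv ℝ g x := by
      ext y; simp [ContinuousLinearEquiv.unitsEquiv_apply]
    rw [hA]
    exact (hasFDerivAt_id x).add hgd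
  choose A hA using hfd
  have hsymm : ContDiff ℝ ∞ h.symm := h.contDiff_symm (f₀' := A) hA hf
  refine ⟨diffeoOfInverse f h.symm hf hsymm h.left_inv h.right_inv, fun x y => ?_, fun x => rfl⟩
  change ‖(x + g x) - (y + g y)‖ ≤ _ ∧ _ ≤ Λ * ‖(x + g x) - (y + g y)‖
  have h1 := hgL x y
  have e : x + g x - (y + g y) = (x - y) + (g x - g y) := by abel
  have h0 := norm_nonneg (x - y)
  rw [e]
  constructor
  · refine (norm_add_le _ _).trans ?_
    have : 1 + c ≤ Λ := by nlinarith [mul_nonneg hc0 hc0]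
    nlinarith
  · have h2 := norm_sub_le_norm_add (x - y) (g x - g y)
    have h3 : (1 - c) * ‖x - y‖ ≤ ‖x - y + (g x - g y)‖ := by linarith
    calc ‖x - y‖ = Λ * ((1 - c) * ‖x - y‖) := by rw [← mul_assoc, hcΛ, one_mul]
      _ ≤ _ := by gcongr

/-- Small displacements of separated points are realised by near-isometric diffeomorphisms. -/
theorem exists_slide (ι : Type*) [Fintype ι] {Λ : ℝ} (hΛ : 1 < Λ) :
    ∃ η : ℝ, 0 < η ∧ ∀ r : ℝ, 0 < r → ∀ p q : ι → E, (∀ i j, i ≠ j → r ≤ ‖q i - q j‖) →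
      (∀ i, ‖p i - q i‖ ≤ η * r) →
      ∃ Φ : Diffeomorph 𝓘(ℝ, E) 𝓘(ℝ, E) E E ∞, IsNearIsometry Λ Φ ∧ ∀ i, Φ (p i) = q i := by
  classical
  obtain ⟨c, hc, hcΦ⟩ := exists_diffeo_add_of_lipschitz (E := E) hΛ
  -- Rescaled by `r` about `q i`, the bump is 1 at `p i`, which is within `r / 4`, and 0 at every
  -- other `p j`, which is at distance at least `3r / 4`.
  let ψ : ContDiffBump (0 : E) := ⟨1 / 4, 1 / 2, by norm_num, by norm_num⟩
  have hψs : ContDiff ℝ ∞ ψ := ψ.contDiff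
  obtain ⟨L, hL⟩ := hψs.lipschitzWith_of_hasCompactSupport ψ.hasCompactSupport (by simp)
  set N : ℝ := (Fintype.card ι : ℝ)
  have hD : 0 < N * L + 1 := by positivity
  refine ⟨min (1 / 4) (c / (N * L + 1)), by positivity, fun r hr p q hq hpq => ?_⟩
  set η : ℝ := min (1 / 4) (c / (N * L + 1)) with hη
  have hη4 : η ≤ 1 / 4 := min_le_left _ _
  have hηc : N * L * η ≤ c := by
    have h1 : η * (N * L + 1) ≤ c := by rw [← le_div_iff₀ hD]; exact min_le_right _ _
    have h2 : 0 ≤ η := by positivity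
    linarith
  let g : E → E := fun x => ∑ i, ψ (r⁻¹ • (x - q i)) • (q i - p i)
  have hg : ContDiff ℝ ∞ g := ContDiff.sum fun i _ =>
    (hψs.comp (contDiff_const.smul (contDiff_id.sub contDiff_const))).smul contDiff_const
  have hgL : ∀ x y, ‖g x - g y‖ ≤ c * ‖x - y‖ := fun x y => by
    have hterm : ∀ i, ‖ψ (r⁻¹ • (x - q i)) • (q i - p i) - ψ (r⁻¹ • (y - q i)) • (q i - p i)‖
        ≤ L * η * ‖x - y‖ := fun i => by
      rw [← sub_smul, norm_smul]
      have h1 : ‖ψ (r⁻¹ • (x - q i)) - ψ (r⁻¹ • (y - q i))‖ ≤ L * (r⁻¹ * ‖x - y‖) := by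
        have := hL.dist_le_mul (r⁻¹ • (x - q i)) (r⁻¹ • (y - q i))
        rw [dist_eq_norm, dist_eq_norm, ← smul_sub, sub_sub_sub_cancel_right, norm_smul,
          norm_inv, Real.norm_of_nonneg hr.le] at this
        exact this
      calc _ ≤ L * (r⁻¹ * ‖x - y‖) * (η * r) := by
            gcongr
            rw [norm_sub_rev]; exact hpq i
        _ = _ := by field_simp
    calc ‖g x - g y‖ = ‖∑ i, (ψ (r⁻¹ • (x - q i)) • (q i - p i)
          - ψ (r⁻¹ • (y - q i)) • (q i - p i))‖ := by rw [Finset.sum_sub_distrib]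
      _ ≤ ∑ _i : ι, L * η * ‖x - y‖ := norm_sum_le_of_le _ fun i _ => hterm i
      _ = N * L * η * ‖x - y‖ := by
          rw [Finset.sum_const, nsmul_eq_mul, Finset.card_univ]; ring
      _ ≤ _ := by gcongr
  obtain ⟨Φ, hΦ, hΦe⟩ := hcΦ g hg hgL
  refine ⟨Φ, hΦ, fun i => ?_⟩
  have hscale : ∀ j, ‖r⁻¹ • (p i - q j)‖ = ‖p i - q j‖ / r := fun j => by
    rw [norm_smul, norm_inv, Real.norm_of_nonneg hr.le, div_eq_inv_mul]
  have hsum : g (p i) = q i - p i := by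
    simp only [g]
    rw [Finset.sum_eq_single i]
    · rw [ψ.one_of_mem_closedBall, one_smul]
      rw [mem_closedBall_zero_iff, hscale, div_le_iff₀ hr]
      exact (hpq i).trans (by gcongr)
    · intro j _ hj
      rw [ψ.zero_of_le_dist, zero_smul]
      rw [dist_zero_right, hscale, le_div_iff₀ hr]
      change 1 / 2 * r ≤ _
      have h1 := hq i j hj.symm
      have h2 : ‖q i - q j‖ ≤ ‖p i - q j‖ + ‖p i - q i‖ := by
        have : q i - q j = (p i - q j) - (p i - q i) := by abel
        rw [this]; exact norm_sub_le _ _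
      have h3 : η * r ≤ 1 / 4 * r := by gcongr
      linarith [hpq i]
    · simp
  rw [hΦe, hsum]; abel

end Slide

/-- Splits the distortion budget among `N` composed maps. -/
theorem exists_one_lt_pow_le (N : ℕ) {Λ : ℝ} (hΛ : 1 < Λ) : ∃ μ : ℝ, 1 < μ ∧ μ ^ N ≤ Λ := by
  have ht : Filter.Tendsto (fun μ : ℝ => μ ^ N) (nhdsWithin 1 (Set.Ioi 1)) (nhds 1) := by
    have := ((continuous_pow N).tendsto (1 : ℝ)).mono_left
      (nhdsWithin_le_nhds (s := Set.Ioi (1 : ℝ)))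
    simpa using this
  obtain ⟨μ, h1, h2⟩ := ((ht.eventually (gt_mem_nhds hΛ)).and self_mem_nhdsWithin).exists
  exact ⟨μ, h2, h1.le⟩

/-! ### Cutting off even products of reflections. -/

section TwistList

variable {E : Type*} [NormedAddCommGroup E] [InnerProductSpace ℝ E] [FiniteDimensional ℝ E]

/-- The composition of the reflections in the hyperplanes orthogonal to the given vectors. -/
noncomputable def reflectionProd (l : List E) : E ≃ₗᵢ[ℝ] E :=
  (l.map fun v => (ℝ ∙ v)ᗮ.reflection).prod

theorem exists_nonzero_reflectionProd (A : E ≃ₗᵢ[ℝ] E) :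
    ∃ l : List E, (∀ v ∈ l, v ≠ 0) ∧ l.length ≤ finrank ℝ E ∧ reflectionProd l = A := by
  classical
  obtain ⟨l, hl, hA⟩ := A.reflections_generate_dim
  refine ⟨l.filter (· ≠ 0), fun v hv => by simpa using (List.mem_filter.1 hv).2,
    (List.length_filter_le _ _).trans hl, ?_⟩
  rw [hA]
  clear hA hl
  induction l with
  | nil => rfl
  | cons a l ih =>
    by_cases ha : a = 0
    · have h1 : (ℝ ∙ (0 : E))ᗮ.reflection = 1 := by
        ext x; rw [reflection_orthogonal_singleton_apply]; simp
      subst ha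
      rw [List.map_cons, List.prod_cons, h1, one_mul, ← ih]
      simp
    · rw [List.map_cons, List.prod_cons, ← ih]
      simp [reflectionProd, ha]

/-- Compose the twists of consecutive pairs. Inside radius `ρ` each is a linear isometry, so the
ball is preserved and the same `ρ` and `K` serve all pairs. -/
theorem exists_twist_list (n : ℕ) {Λ : ℝ} (hΛ : 1 < Λ) :
    ∃ K : ℝ, 1 ≤ K ∧ ∀ l : List E, (∀ v ∈ l, v ≠ 0) → l.length = 2 * n →
      ∀ ρ : ℝ, 0 < ρ → ∃ Φ : Diffeomorph 𝓘(ℝ, E) 𝓘(ℝ, E) E E ∞, IsNearIsometry (Λ ^ n) Φ ∧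
        (∀ x, ‖x‖ ≤ ρ → Φ x = reflectionProd l x) ∧ ∀ x, K * ρ ≤ ‖x‖ → Φ x = x := by
  obtain ⟨K, hK, h⟩ := exists_twist_pair (E := E) hΛ
  refine ⟨K, hK, ?_⟩
  induction n with
  | zero =>
    intro l _ hl ρ hρ
    obtain rfl : l = [] := List.length_eq_zero_iff.1 (by simpa using hl)
    exact ⟨Diffeomorph.refl 𝓘(ℝ, E) E ∞, by simpa using isNearIsometry_refl,
      fun x _ => by simp [reflectionProd], fun x _ => rfl⟩
  | succ n ih =>
    intro l hl0 hl ρ hρ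
    match l, hl with
    | u :: v :: l, hl =>
      obtain ⟨Φ, hΦ, hΦ1, hΦ2⟩ := h u v (hl0 u (by simp)) (hl0 v (by simp)) ρ hρ
      obtain ⟨Ψ, hΨ, hΨ1, hΨ2⟩ := ih l (fun w hw => hl0 w (by simp [hw]))
        (by simp at hl; omega) ρ hρ
      refine ⟨Ψ.trans Φ, ?_, fun x hx => ?_, fun x hx => ?_⟩
      · rw [pow_succ]
        exact hΨ.trans (by positivity) (by positivity) hΦ
      · rw [Diffeomorph.coe_trans, Function.comp_apply, hΨ1 x hx, hΦ1 _ (by simpa using hx)]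
        simp [reflectionProd]
      · rw [Diffeomorph.coe_trans, Function.comp_apply, hΨ2 x hx, hΦ2 x hx]

/-- A product of an even number of reflections, centred at `a`, can be cut off to the identity at
small distortion. -/
theorem exists_twist {Λ : ℝ} (hΛ : 1 < Λ) (N : ℕ) :
    ∃ K : ℝ, 1 ≤ K ∧ ∀ l : List E, (∀ v ∈ l, v ≠ 0) → l.length ≤ 2 * N → Even l.length →
      ∀ (a : E) (ρ : ℝ), 0 < ρ → ∃ Φ : Diffeomorph 𝓘(ℝ, E) 𝓘(ℝ, E) E E ∞, IsNearIsometry Λ Φ ∧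
        (∀ x, ‖x - a‖ ≤ ρ → Φ x = a + reflectionProd l (x - a)) ∧
        ∀ x, K * ρ ≤ ‖x - a‖ → Φ x = x := by
  obtain ⟨μ, hμ1, hμ⟩ := exists_one_lt_pow_le N hΛ
  choose K hK h using fun n => exists_twist_list (E := E) n hμ1
  have hKmax : ∀ n ≤ N, K n ≤ ∑ m ∈ Finset.range (N + 1), K m := fun n hn =>
    Finset.single_le_sum (f := K) (fun i _ => zero_le_one.trans (hK i))
      (Finset.mem_range.2 (Nat.lt_succ_of_le hn))
  refine ⟨∑ m ∈ Finset.range (N + 1), K m, (hK 0).trans (hKmax 0 (Nat.zero_le _)),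
    fun l hl0 hlN hl a ρ hρ => ?_⟩
  obtain ⟨n, hn⟩ := hl
  have hnN : n ≤ N := by omega
  obtain ⟨Φ, hΦ, hΦ1, hΦ2⟩ := h n l hl0 (by omega) ρ hρ
  refine ⟨((translationDiffeo (-a)).trans Φ).trans (translationDiffeo a), ?_, fun x hx => ?_,
    fun x hx => ?_⟩
  · have hp : (1 : ℝ) ≤ μ ^ n := one_le_pow₀ hμ1.le
    have := ((isNearIsometry_translationDiffeo (-a)).trans zero_le_one (by positivity) hΦ).trans
      (by positivity) zero_le_one (isNearIsometry_translationDiffeo a)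
    refine this.mono ?_
    rw [one_mul, mul_one]
    exact (pow_le_pow_right₀ hμ1.le hnN).trans hμ
  · simp only [Diffeomorph.coe_trans, Function.comp_apply, translationDiffeo_apply,
      ← sub_eq_add_neg]
    rw [hΦ1 _ hx, add_comm]
  · simp only [Diffeomorph.coe_trans, Function.comp_apply, translationDiffeo_apply,
      ← sub_eq_add_neg]
    rw [hΦ2 _ (le_trans (by gcongr; exact hKmax n hnN) hx), sub_add_cancel]

end TwistList

/-- The point at the origin adds nothing to the span, which therefore has dimension at most `card ι
- 1` and is a proper subspace. -/
theorem exists_ne_zero_inner_eq_zero {E : Type*} [NormedAddCommGroup E]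
    [InnerProductSpace ℝ E] {ι : Type*} [Fintype ι] (hι : Fintype.card ι ≤ finrank ℝ E) (p : ι → E)
    (j₀ : ι) (hj₀ : p j₀ = 0) : ∃ w : E, w ≠ 0 ∧ ∀ i, inner ℝ w (p i) = 0 := by
  classical
  set S : Submodule ℝ E := span ℝ (((Finset.univ.erase j₀).image p : Finset E) : Set E) with hS
  have hcard : finrank ℝ S < finrank ℝ E := by
    have h1 : finrank ℝ S ≤ ((Finset.univ.erase j₀).image p).card := finrank_span_finset_le_card _
    have h2 : ((Finset.univ.erase j₀).image p).card ≤ (Finset.univ.erase j₀).card :=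
      Finset.card_image_le
    rw [Finset.card_erase_of_mem (Finset.mem_univ _), Finset.card_univ] at h2
    have h3 : 0 < Fintype.card ι := Fintype.card_pos_iff.2 ⟨j₀⟩
    omega
  have hne : Sᗮ ≠ ⊥ := fun h => by
    rw [Submodule.orthogonal_eq_bot_iff] at h
    rw [h, finrank_top] at hcard
    exact lt_irrefl _ hcard
  obtain ⟨w, hw, hw0⟩ := Submodule.exists_mem_ne_zero_of_ne_bot hne
  refine ⟨w, hw0, fun i => ?_⟩
  by_cases hi : i = j₀
  · rw [hi, hj₀, inner_zero_right]
  · refine (Submodule.mem_orthogonal' S w).1 hw _ (subset_span ?_)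
    simpa using ⟨i, hi, rfl⟩

/-! ### Matching configurations by linear isometries. -/

section Alignment

variable {E : Type*} [NormedAddCommGroup E] [InnerProductSpace ℝ E] [FiniteDimensional ℝ E]

/-- Two finite families with the same norms and mutual distances differ by a linear isometry. -/
theorem exists_linearIsometryEquiv_apply_eq {ι : Type*} [Fintype ι] {p q : ι → E}
    (hn : ∀ i, ‖p i‖ = ‖q i‖) (hd : ∀ i j, ‖p i - p j‖ = ‖q i - q j‖) :
    ∃ A : E ≃ₗᵢ[ℝ] E, ∀ i, A (p i) = q i := by
  classical
  have hin : ∀ i j, inner ℝ (p i) (p j) = inner ℝ (q i) (q j) := fun i j => by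
    rw [real_inner_eq_norm_mul_self_add_norm_mul_self_sub_norm_sub_mul_self_div_two,
      real_inner_eq_norm_mul_self_add_norm_mul_self_sub_norm_sub_mul_self_div_two, hn, hn, hd]
  let P : (ι → ℝ) →ₗ[ℝ] E := Fintype.linearCombination ℝ p
  let Q : (ι → ℝ) →ₗ[ℝ] E := Fintype.linearCombination ℝ q
  have hPQ : ∀ c, ‖P c‖ = ‖Q c‖ := fun c => by
    have h : inner ℝ (P c) (P c) = inner ℝ (Q c) (Q c) := by
      simp only [P, Q, Fintype.linearCombination_apply, sum_inner, inner_sum, inner_smul_left,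
        inner_smul_right, hin]
    rw [real_inner_self_eq_norm_sq, real_inner_self_eq_norm_sq] at h
    exact (sq_eq_sq₀ (norm_nonneg _) (norm_nonneg _)).1 h
  have hker : P.ker ≤ Q.ker := fun c hc => by
    rw [LinearMap.mem_ker] at hc ⊢
    -- Equal Gram matrices make `P c ↦ Q c` a well-defined isometry on the range of `P`, which then
    -- extends to the whole space.
    rw [← norm_eq_zero, ← hPQ, hc, norm_zero]
  let L₀ : P.range →ₗ[ℝ] E := (P.ker.liftQ Q hker) ∘ₗ P.quotKerEquivRange.symm.toLinearMap
  have hL₀ : ∀ c, L₀ ⟨P c, P.mem_range_self c⟩ = Q c := fun c => by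
    simp only [L₀, LinearMap.comp_apply, LinearEquiv.coe_coe]
    rw [LinearMap.quotKerEquivRange_symm_apply_image]
    simp
  let L : P.range →ₗᵢ[ℝ] E := ⟨L₀, by
    rintro ⟨_, c, rfl⟩
    rw [hL₀, ← hPQ]; rfl⟩
  refine ⟨L.extend.toLinearIsometryEquiv rfl, fun i => ?_⟩
  have hp : P (Pi.single i 1) = p i := by simp [P]
  have hq : Q (Pi.single i 1) = q i := by simp [Q]
  rw [LinearIsometry.coe_toLinearIsometryEquiv]
  calc L.extend (p i) = L.extend (P (Pi.single i 1)) := by rw [hp]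
    _ = L₀ ⟨P (Pi.single i 1), P.mem_range_self _⟩ := L.extend_apply ⟨P (Pi.single i 1), P.mem_range_self _⟩
    _ = q i := by rw [hL₀, hq]

/-- Bounded families with almost equal norms and mutual distances are almost matched by a linear
isometry. -/
theorem exists_approx_linearIsometryEquiv (ι : Type*) [Fintype ι] (M : ℝ) {η : ℝ} (hη : 0 < η) :
    ∃ δ : ℝ, 0 < δ ∧ ∀ p q : ι → E, (∀ i, ‖p i‖ ≤ M) → (∀ i, ‖q i‖ ≤ M) →
      (∀ i, |‖p i‖ - ‖q i‖| ≤ δ) → (∀ i j, |‖p i - p j‖ - ‖q i - q j‖| ≤ δ) →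
      ∃ A : E ≃ₗᵢ[ℝ] E, ∀ i, ‖A (p i) - q i‖ ≤ η := by
  rcases lt_or_ge M 0 with hM | hM
  · refine ⟨1, one_pos, fun p q hp _ _ _ => ⟨LinearIsometryEquiv.refl ℝ E, fun i => ?_⟩⟩
    exact absurd ((norm_nonneg _).trans (hp i)) (not_le.2 hM)
  -- Counterexamples for `δ = 1 / (n + 1)` stay in a compact ball. A subsequential limit has equal
  -- norms and distances, so an isometry matches it exactly, and this isometry works within `η` for
  -- some `n`.
  by_contra hcon
  have hcon' : ∀ n : ℕ, ∃ x : (ι → E) × (ι → E), (∀ i, ‖x.1 i‖ ≤ M) ∧ (∀ i, ‖x.2 i‖ ≤ M) ∧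
      (∀ i, |‖x.1 i‖ - ‖x.2 i‖| ≤ 1 / ((n : ℝ) + 1)) ∧
      (∀ i j, |‖x.1 i - x.1 j‖ - ‖x.2 i - x.2 j‖| ≤ 1 / ((n : ℝ) + 1)) ∧
      ∀ A : E ≃ₗᵢ[ℝ] E, ∃ i, η < ‖A (x.1 i) - x.2 i‖ := fun n => by
    by_contra h
    refine hcon ⟨1 / ((n : ℝ) + 1), by positivity, fun p q h1 h2 h3 h4 => ?_⟩
    by_contra h5
    exact h ⟨(p, q), h1, h2, h3, h4, fun A => by
      by_contra h6
      exact h5 ⟨A, fun i => not_lt.1 fun h7 => h6 ⟨i, h7⟩⟩⟩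
  choose x hx1 hx2 hx3 hx4 hx5 using hcon'
  have hmem : ∀ n, x n ∈ closedBall (0 : (ι → E) × (ι → E)) M := fun n => by
    rw [mem_closedBall_zero_iff, Prod.norm_def]
    exact max_le ((pi_norm_le_iff_of_nonneg hM).2 (hx1 n)) ((pi_norm_le_iff_of_nonneg hM).2 (hx2 n))
  obtain ⟨⟨p, q⟩, -, φ, hφ, hlim⟩ := (isCompact_closedBall _ _).tendsto_subseq hmem
  have hp : ∀ i, Filter.Tendsto (fun n => (x (φ n)).1 i) Filter.atTop (nhds (p i)) := fun i =>
    (((continuous_apply i).comp continuous_fst).tendsto (p, q)).comp hlim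
  have hq : ∀ i, Filter.Tendsto (fun n => (x (φ n)).2 i) Filter.atTop (nhds (q i)) := fun i =>
    (((continuous_apply i).comp continuous_snd).tendsto (p, q)).comp hlim
  have h0 : Filter.Tendsto (fun n => 1 / ((φ n : ℝ) + 1)) Filter.atTop (nhds 0) :=
    tendsto_one_div_add_atTop_nhds_zero_nat.comp hφ.tendsto_atTop
  have hn : ∀ i, ‖p i‖ = ‖q i‖ := fun i => by
    have h1 := ((hp i).norm.sub (hq i).norm).abs
    have h2 := le_of_tendsto_of_tendsto' h1 h0 fun n => hx3 (φ n) i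
    exact sub_eq_zero.1 (abs_eq_zero.1 (le_antisymm h2 (abs_nonneg _)))
  have hd : ∀ i j, ‖p i - p j‖ = ‖q i - q j‖ := fun i j => by
    have h1 := (((hp i).sub (hp j)).norm.sub ((hq i).sub (hq j)).norm).abs
    have h2 := le_of_tendsto_of_tendsto' h1 h0 fun n => hx4 (φ n) i j
    exact sub_eq_zero.1 (abs_eq_zero.1 (le_antisymm h2 (abs_nonneg _)))
  obtain ⟨A, hA⟩ := exists_linearIsometryEquiv_apply_eq hn hd
  have hev : ∀ i, ∀ᶠ n in Filter.atTop, ‖A ((x (φ n)).1 i) - (x (φ n)).2 i‖ < η := fun i => by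
    have h1 := (((A.continuous.tendsto (p i)).comp (hp i)).sub (hq i)).norm
    rw [hA, sub_self, norm_zero] at h1
    exact h1.eventually (gt_mem_nhds hη)
  obtain ⟨n, hn'⟩ := (Filter.eventually_all.2 hev).exists
  obtain ⟨i, hi⟩ := hx5 (φ n) A
  exact lt_asymm hi (hn' i)

/-- A linear isometry may be replaced by a product of an even number of reflections without changing
it on at most `finrank ℝ E` points, one of which is the origin. -/
theorem exists_even_reflectionProd {ι : Type*} [Fintype ι] (hι : Fintype.card ι ≤ finrank ℝ E)
    (p : ι → E) (j₀ : ι) (hj₀ : p j₀ = 0) (A : E ≃ₗᵢ[ℝ] E) :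
    ∃ l : List E, (∀ v ∈ l, v ≠ 0) ∧ l.length ≤ finrank ℝ E + 1 ∧ Even l.length ∧
      ∀ i, reflectionProd l (p i) = A (p i) := by
  obtain ⟨l, hl0, hl, hA⟩ := exists_nonzero_reflectionProd A
  rcases Nat.even_or_odd l.length with he | ho
  · exact ⟨l, hl0, by omega, he, fun i => by rw [hA]⟩
  · obtain ⟨w, hw0, hw⟩ := exists_ne_zero_inner_eq_zero hι p j₀ hj₀
    -- The appended reflection acts first and fixes every `p i`, so only the parity changes.
    refine ⟨l ++ [w], ?_, by simpa using hl, by simpa using ho.add_odd odd_one, fun i => ?_⟩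
    · intro v hv
      rcases List.mem_append.1 hv with h | h
      · exact hl0 v h
      · rwa [List.mem_singleton.1 h]
    · have h : reflectionProd (l ++ [w]) = reflectionProd l * (ℝ ∙ w)ᗮ.reflection := by
        simp [reflectionProd]
      have hr : (ℝ ∙ w)ᗮ.reflection (p i) = p i := by
        rw [reflection_orthogonal_singleton_apply, hw]; simp
      rw [h, LinearIsometryEquiv.coe_mul, Function.comp_apply, hr, hA]

end Alignment

/-- Pigeonhole: the `card ι + 1` open intervals from `ρ * K ^ l` to `ρ * K ^ (l + 1)` are disjoint,
so they cannot all contain some `d i`. -/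
theorem exists_empty_annulus {ι : Type*} [Fintype ι] (d : ι → ℝ) {K ρ : ℝ} (hK : 1 ≤ K)
    (hρ : 0 < ρ) : ∃ l ≤ Fintype.card ι, ∀ i, d i ≤ ρ * K ^ l ∨ K * (ρ * K ^ l) ≤ d i := by
  by_contra hcon
  have h : ∀ l : Fin (Fintype.card ι + 1), ∃ i, ρ * K ^ (l : ℕ) < d i ∧
      d i < K * (ρ * K ^ (l : ℕ)) := fun l => by
    by_contra h
    refine hcon ⟨l, Nat.lt_succ_iff.1 l.2, fun i => ?_⟩
    by_contra h'
    rw [not_or, not_le, not_le] at h'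
    exact h ⟨i, h'⟩
  choose f hf using h
  have key : ∀ a b : Fin (Fintype.card ι + 1), a < b → f a ≠ f b := fun a b hab he => by
    have h1 := (hf a).2
    have h2 := (hf b).1
    rw [he] at h1
    have h3 : ρ * K ^ ((a : ℕ) + 1) ≤ ρ * K ^ (b : ℕ) := by
      gcongr
      exact hab
    rw [pow_succ] at h3
    linarith
  obtain ⟨a, b, hab, he⟩ := Fintype.exists_ne_map_eq_of_card_lt f (by simp)
  rcases lt_or_gt_of_ne hab with h | h
  · exact key a b h he
  · exact key b a h he.symm

/-! ### Moving one point, and the induction. -/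

section Interpolation

variable {E : Type*} [NormedAddCommGroup E] [InnerProductSpace ℝ E] [FiniteDimensional ℝ E]

/-- If two near-isometric configurations differ in one point only, and that point lies at the
minimal scale of the configuration, a near-isometric diffeomorphism maps one to the other. -/
theorem exists_move_one_point {ι : Type*} [Fintype ι] (hι : Fintype.card ι ≤ finrank ℝ E) {Λ : ℝ}
    (hΛ : 1 < Λ) :
    ∃ δ : ℝ, 0 < δ ∧ ∀ r : ℝ, 0 < r → ∀ (p q : ι → E) (i₀ j₀ : ι), i₀ ≠ j₀ →
      (∀ i, i ≠ i₀ → p i = q i) → ‖p i₀ - p j₀‖ ≤ 4 * r → ‖q i₀ - q j₀‖ ≤ 4 * r →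
      (∀ i j, i ≠ j → r ≤ ‖q i - q j‖) →
      (∀ i j, ‖p i - p j‖ ≤ (1 + δ) * ‖q i - q j‖ ∧ ‖q i - q j‖ ≤ (1 + δ) * ‖p i - p j‖) →
      ∃ Φ : Diffeomorph 𝓘(ℝ, E) 𝓘(ℝ, E) E E ∞, IsNearIsometry Λ Φ ∧ ∀ i, Φ (p i) = q i := by
  classical
  obtain ⟨μ, hμ1, hμ⟩ := exists_one_lt_pow_le 2 hΛ
  obtain ⟨K, hK, hT⟩ := exists_twist (E := E) hμ1 (finrank ℝ E + 1)
  obtain ⟨η, hη, hS⟩ := exists_slide (E := E) ι hμ1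
  set M : ℝ := 4 * K ^ Fintype.card ι with hM
  have hK1 : ∀ n : ℕ, 1 ≤ K ^ n := fun n => one_le_pow₀ hK
  have hM4 : 4 ≤ M := by have := hK1 (Fintype.card ι); linarith
  obtain ⟨δ, hδ, hA⟩ := exists_approx_linearIsometryEquiv (E := E) ι M hη
  -- Distances within the cluster are at most `2 * M * r`, so this relative error becomes an
  -- absolute error `δ` after rescaling by `r⁻¹`.
  refine ⟨δ / (2 * M), by positivity, fun r hr p q i₀ j₀ hij hpq hp₀ hq₀ hq hnear => ?_⟩
  obtain ⟨l, hl, hgap⟩ := exists_empty_annulus (fun i => ‖p i - p j₀‖) hK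
    (show 0 < 4 * r by positivity)
  set ρ : ℝ := 4 * r * K ^ l with hρ
  have hρ4 : 4 * r ≤ ρ := le_mul_of_one_le_right (by positivity) (hK1 l)
  have hρM : ρ ≤ M * r := by
    have : K ^ l ≤ K ^ Fintype.card ι := pow_le_pow_right₀ hK hl
    calc ρ ≤ 4 * r * K ^ Fintype.card ι := by rw [hρ]; gcongr
      _ = _ := by rw [hM]; ring
  have hpq₀ : p j₀ = q j₀ := hpq j₀ hij.symm
  -- Points beyond the annulus are collapsed to the centre, so the bounded cluster is still indexed
  -- by `ι`.
  let c : ι → ι := fun i => if ‖p i - p j₀‖ ≤ ρ then i else j₀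
  have hcp : ∀ i, ‖p (c i) - p j₀‖ ≤ M * r := fun i => by
    by_cases h : ‖p i - p j₀‖ ≤ ρ
    · simp only [c, if_pos h]; exact h.trans hρM
    · simp only [c, if_neg h, sub_self, norm_zero]; positivity
  have hcq : ∀ i, ‖q (c i) - q j₀‖ ≤ M * r := fun i => by
    by_cases h : c i = i₀
    · rw [h]; exact hq₀.trans (by gcongr)
    · rw [← hpq _ h, ← hpq₀]; exact hcp i
  have hdiff : ∀ i j, ‖p i - p j‖ ≤ 2 * M * r → ‖q i - q j‖ ≤ 2 * M * r →
      |‖r⁻¹ • (p i - p j)‖ - ‖r⁻¹ • (q i - q j)‖| ≤ δ := fun i j h1 h2 => by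
    have h3 := hnear i j
    have h4 : ∀ t, t ≤ 2 * M * r → δ / (2 * M) * t ≤ δ * r := fun t ht => by
      calc _ ≤ δ / (2 * M) * (2 * M * r) := by gcongr
        _ = _ := by field_simp
    have h5 := h4 _ h1
    have h6 := h4 _ h2
    rw [norm_smul, norm_smul, ← mul_sub, abs_mul, norm_inv, Real.norm_of_nonneg hr.le,
      abs_of_pos (inv_pos.2 hr), inv_mul_le_iff₀ hr, abs_le]
    constructor <;> nlinarith
  have hscale : ∀ v : E, ‖v‖ ≤ M * r → ‖r⁻¹ • v‖ ≤ M := fun v hv => by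
    rw [norm_smul, norm_inv, Real.norm_of_nonneg hr.le, inv_mul_le_iff₀ hr]
    linarith
  have htri : ∀ (s : ι → E) (i j : ι), ‖s i - s j₀‖ ≤ M * r → ‖s j - s j₀‖ ≤ M * r →
      ‖s i - s j‖ ≤ 2 * M * r := fun s i j h1 h2 => by
    rw [← sub_sub_sub_cancel_right (s i) (s j) (s j₀)]
    exact (norm_sub_le _ _).trans (by linarith)
  have hz : ∀ s : E, ‖s - s‖ ≤ M * r := fun s => by rw [sub_self, norm_zero]; positivity
  obtain ⟨A, hAη⟩ := hA (fun i => r⁻¹ • (p (c i) - p j₀)) (fun i => r⁻¹ • (q (c i) - q j₀))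
    (fun i => hscale _ (hcp i)) (fun i => hscale _ (hcq i))
    (fun i => hdiff _ _ (htri p _ _ (hcp i) (hz _)) (htri q _ _ (hcq i) (hz _)))
    (fun i j => by
      simp only [← smul_sub, sub_sub_sub_cancel_right]
      exact hdiff _ _ (htri p _ _ (hcp i) (hcp j)) (htri q _ _ (hcq i) (hcq j)))
  have hcj : c j₀ = j₀ := by simp [c]
  obtain ⟨L, hL0, hLn, hLe, hLA⟩ := exists_even_reflectionProd hι
    (fun i => r⁻¹ • (p (c i) - p j₀)) j₀ (by simp [hcj]) A
  obtain ⟨T, hTμ, hT1, hT2⟩ := hT L hL0 (by omega) hLe (p j₀) ρ (by positivity)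
  -- Inside the annulus the twist lands within `η * r` of the target. Outside it the twist fixes `p
  -- i`, which already equals `q i` since `i₀` lies inside.
  obtain ⟨S, hSμ, hS1⟩ := hS r hr (fun i => T (p i)) q hq (fun i => by
    by_cases h : ‖p i - p j₀‖ ≤ ρ
    · have hci : c i = i := if_pos h
      have h1 := hAη i
      rw [← hLA i] at h1
      simp only [hci] at h1
      rw [map_smul, ← smul_sub, norm_smul, norm_inv, Real.norm_of_nonneg hr.le,
        inv_mul_le_iff₀ hr] at h1
      rw [hT1 _ h, mul_comm, ← sub_sub_sub_cancel_right _ (q i) (q j₀), ← hpq₀, add_sub_cancel_left,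
        hpq₀]
      rwa [hpq₀] at h1
    · have hi : i ≠ i₀ := by
        rintro rfl
        exact h (hp₀.trans hρ4)
      rw [hT2 _ ((hgap i).resolve_left h), hpq i hi, sub_self, norm_zero]; positivity)
  refine ⟨T.trans S, ?_, fun i => hS1 i⟩
  exact (hTμ.trans (by positivity) (by positivity) hSμ).mono (by rwa [← sq])

/-- **Interpolation of near-isometries of few points.** -/
theorem exists_interpolating_nearIsometry (n : ℕ) (hn : n ≤ finrank ℝ E) {Λ : ℝ} (hΛ : 1 < Λ) :
    ∃ δ : ℝ, 0 < δ ∧ ∀ y z : Fin n → E, Function.Injective y →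
      (∀ i j, ‖z i - z j‖ ≤ (1 + δ) * ‖y i - y j‖ ∧ ‖y i - y j‖ ≤ (1 + δ) * ‖z i - z j‖) →
      ∃ Φ : Diffeomorph 𝓘(ℝ, E) 𝓘(ℝ, E) E E ∞, IsNearIsometry Λ Φ ∧ ∀ i, Φ (y i) = z i := by
  induction n generalizing Λ with
  | zero =>
    exact ⟨1, one_pos, fun y z _ _ =>
      ⟨Diffeomorph.refl 𝓘(ℝ, E) E ∞, isNearIsometry_refl.mono hΛ.le, fun i => i.elim0⟩⟩
  | succ n ih =>
    rcases Nat.eq_zero_or_pos n with rfl | hn0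
    · refine ⟨1, one_pos, fun y z _ _ => ⟨translationDiffeo (z 0 - y 0),
        (isNearIsometry_translationDiffeo _).mono hΛ.le, fun i => ?_⟩⟩
      rw [Fin.fin_one_eq_zero i, translationDiffeo_apply]; abel
    obtain ⟨μ, hμ1, hμ⟩ := exists_one_lt_pow_le 2 hΛ
    obtain ⟨δ₁, hδ₁, hmove⟩ := exists_move_one_point (E := E) (ι := Fin (n + 1)) (by simpa using hn)
      hμ1
    -- The three bounds on `ν ^ 2` serve in turn to compare `Φ ∘ y` with `z` within `1 + δ₁`, to
    -- keep the closest pair within four times the scale, and to bound the final distortion by `μ ^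
    -- 2`.
    obtain ⟨ν, hν1, hν⟩ := exists_one_lt_pow_le 2
      (show 1 < min (1 + δ₁) (min 2 μ) from lt_min (by linarith) (lt_min one_lt_two hμ1))
    have hν2 : ν ≤ ν ^ 2 := le_self_pow₀ hν1.le two_ne_zero
    have hνδ : ν ^ 2 ≤ 1 + δ₁ := hν.trans (min_le_left _ _)
    have hνt : ν ^ 2 ≤ 2 := hν.trans ((min_le_right _ _).trans (min_le_left _ _))
    have hνμ : ν ^ 2 ≤ μ := hν.trans ((min_le_right _ _).trans (min_le_right _ _))
    obtain ⟨δ₂, hδ₂, hind⟩ := ih (by omega) hν1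
    refine ⟨min δ₂ (ν - 1), lt_min hδ₂ (by linarith), fun y z hy hyz => ?_⟩
    have hyz₂ : ∀ i j, ‖z i - z j‖ ≤ (1 + δ₂) * ‖y i - y j‖ ∧
        ‖y i - y j‖ ≤ (1 + δ₂) * ‖z i - z j‖ := fun i j =>
      ⟨(hyz i j).1.trans (by gcongr; exact min_le_left _ _),
        (hyz i j).2.trans (by gcongr; exact min_le_left _ _)⟩
    have hyzν : ∀ i j, ‖z i - z j‖ ≤ ν * ‖y i - y j‖ ∧ ‖y i - y j‖ ≤ ν * ‖z i - z j‖ := fun i j => by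
      have h : 1 + min δ₂ (ν - 1) ≤ ν := by linarith [min_le_right δ₂ (ν - 1)]
      exact ⟨(hyz i j).1.trans (by gcongr), (hyz i j).2.trans (by gcongr)⟩
    obtain ⟨⟨i₀, j₀⟩, hij, hmin⟩ := Finset.exists_min_image
      (Finset.univ : Finset (Fin (n + 1))).offDiag (fun s => ‖y s.1 - y s.2‖)
      ⟨(0, Fin.last n), by simp [Fin.ext_iff]; omega⟩
    have hij' : i₀ ≠ j₀ := by simpa using hij
    have hmin' : ∀ i j, i ≠ j → ‖y i₀ - y j₀‖ ≤ ‖y i - y j‖ := fun i j h =>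
      hmin (i, j) (by simpa using h)
    have hr : 0 < ‖y i₀ - y j₀‖ := norm_pos_iff.2 (sub_ne_zero.2 (hy.ne hij'))
    obtain ⟨Φ, hΦν, hΦ⟩ := hind (fun i => y (i₀.succAbove i)) (fun i => z (i₀.succAbove i))
      (hy.comp Fin.succAbove_right_injective) (fun i j => hyz₂ _ _)
    have hcomp : ∀ a b c : ℝ, 0 ≤ c → a ≤ ν * b → b ≤ ν * c → a ≤ (1 + δ₁) * c :=
      fun a b c hc h1 h2 => by
        calc a ≤ ν * (ν * c) := h1.trans (by gcongr)
          _ = ν ^ 2 * c := by ring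
          _ ≤ _ := by gcongr
    -- Half the minimal distance: since `ν ≤ 2`, the points `z i` stay separated by this scale, and
    -- both images of the closest pair are at most four times it apart.
    obtain ⟨Ψ, hΨμ, hΨ⟩ := hmove (‖y i₀ - y j₀‖ / 2) (by positivity) (fun i => Φ (y i)) z i₀ j₀ hij'
      (fun i hi => by
        obtain ⟨k, rfl⟩ := Fin.exists_succAbove_eq hi
        exact hΦ k)
      ((hΦν _ _).1.trans (by nlinarith))
      ((hyzν _ _).1.trans (by nlinarith))
      (fun i j h => by
        have h1 := hmin' i j h
        have h2 := (hyzν i j).2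
        have h3 := norm_nonneg (z i - z j)
        nlinarith)
      (fun i j => ⟨hcomp _ _ _ (norm_nonneg _) (hΦν _ _).1 (hyzν i j).2,
        hcomp _ _ _ (norm_nonneg _) (hyzν i j).1 (hΦν _ _).2⟩)
    refine ⟨Φ.trans Ψ, ?_, fun i => hΨ i⟩
    refine (hΦν.trans (by linarith) (by linarith) hΨμ).mono (le_trans ?_ hμ)
    rw [sq]
    gcongr
    linarith

end Interpolation

theorem theoremt (D : ℕ) (hD : 2 ≤ D) :
    ∃ C : ℝ, 0 < C ∧
      ∀ ε : ℝ, 0 < ε → ε < C →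
      ∀ k : ℕ, 1 ≤ k → k ≤ D →
      ∃ δ : ℝ, 0 < δ ∧
        ∀ y z : Fin k → EuclideanSpace ℝ (Fin D),
          IsPointConfiguration y → IsPointConfiguration z →
          (∀ i j : Fin k, i ≠ j →
            (1 + δ)⁻¹ ≤ ‖z i - z j‖ / ‖y i - y j‖ ∧
              ‖z i - z j‖ / ‖y i - y j‖ ≤ 1 + δ) →
          ∃ Φ : Diffeomorph 𝓘(ℝ, EuclideanSpace ℝ (Fin D)) 𝓘(ℝ, EuclideanSpace ℝ (Fin D))
              (EuclideanSpace ℝ (Fin D)) (EuclideanSpace ℝ (Fin D)) ∞,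
            (∀ x x' : EuclideanSpace ℝ (Fin D),
              (1 + ε)⁻¹ * ‖x - x'‖ ≤ ‖Φ x - Φ x'‖ ∧
                ‖Φ x - Φ x'‖ ≤ (1 + ε) * ‖x - x'‖) ∧
            ∀ i : Fin k, Φ (y i) = z i := by
  -- The interpolation works for every `ε > 0`, so the choice of `C` is arbitrary.
  refine ⟨1, one_pos, fun ε hε _ k _ hkD => ?_⟩
  obtain ⟨δ, hδ, h⟩ := exists_interpolating_nearIsometry (E := EuclideanSpace ℝ (Fin D)) k
    (by simpa using hkD) (show 1 < 1 + ε by linarith)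
  refine ⟨δ, hδ, fun y z hy _ hyz => ?_⟩
  obtain ⟨Φ, hΦ, hΦy⟩ := h y z (fun i j hij => not_imp_not.1 (hy i j) hij) (fun i j => by
    by_cases hij : i = j
    · simp [hij]
    have hpos : 0 < ‖y i - y j‖ := norm_pos_iff.2 (sub_ne_zero.2 (hy i j hij))
    obtain ⟨h1, h2⟩ := hyz i j hij
    rw [div_le_iff₀ hpos] at h2
    rw [le_div_iff₀ hpos, inv_mul_le_iff₀ (by positivity)] at h1
    exact ⟨h2, h1⟩)
  refine ⟨Φ, fun x x' => ⟨?_, (hΦ x x').1⟩, hΦy⟩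
  rw [inv_mul_le_iff₀ (by positivity)]
  exact (hΦ x x').2
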